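/- All Banach spaces are real. A Lindenstrauss space is a real Banach space $Y$ whose dual $Y^*$ is isometrically isomorphic to $L_1(\mu)$ for some measure $\mu$. Let $X$ and $Y$ be real Banach spaces, $1\le p<\infty$, let $B_{X^*}$ be the closed unit ball of $X^*$, and let $J_Y\colon Y\to Y^{**}$ be the canonical embedding. A bounded linear operator $L\colon X\to Z$ into a Banach space $Z$ is absolutely $p$-summing if there is a constant $C\ge 0$ such that $$\Big(\sum_{i=1}^m\|L(x_i)\|^p\Big)^{1/p}\le C\sup_{x^*\in B_{X^*}}\Big(\sum_{i=1}^m|x^*(x_i)|^p\Big)^{1/p}$$ for all $m\in\mathbb N$ and $x_1,\dots,x_m\in X$. A map $T\colon X\to Y$ is Lipschitz $p$-dominated if it is Lipschitz and there exist a Banach space $Z$ and an absolutely $p$-summing linear operator $L\colon X\to Z$ such that $\|T(x)-T(y)\|\le\|L(x)-L(y)\|$ for all $x,y\in X$. A map $T\colon X\to Y$ is strongly Lipschitz $p$-integral if it is Lipschitz and there exist a probability space $(\Omega,\Sigma,\mu)$, a bounded linear operator $A\colon X\to L_\infty(\mu)$ and a Lipschitz map $B\colon L_p(\mu)\to Y^{**}$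 such that $J_Y\circ T=B\circ I_{\infty,p}\circ A$, where $I_{\infty,p}\colon L_\infty(\mu)\to L_p(\mu)$ is the canonical inclusion. **Proposition.** Let $X$ be a real Banach space, $Y$ a Lindenstrauss space and $1\le p<\infty$. A map $T\colon X\to Y$ is strongly Lipschitz $p$-integral if and only if it is Lipschitz $p$-dominated. -/

import Mathlib

open MeasureTheory
open scoped ENNReal NNReal

universe u v w

/-- A real normed space `Y` is a Lindenstrauss space if it is complete and its dual is linearly
isometric to `L₁(μ)` for some (arbitrary) measure `μ`. The underlying set of the measure space may
live in any universe `w`. -/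
def IsLindenstrauss (Y : Type v) [NormedAddCommGroup Y] [NormedSpace ℝ Y] : Prop :=
  CompleteSpace Y ∧
    ∃ (Ω : Type w) (_ : MeasurableSpace Ω) (μ : Measure Ω),
      Nonempty (StrongDual ℝ Y ≃ₗᵢ[ℝ] Lp ℝ 1 μ)

/-- The canonical operator `I_{∞,p} : L_∞(μ) → L_p(μ)` for a finite measure `μ`: it sends a class of
functions modulo `μ`-a.e. equality to the same class. -/
def inclusionLinftyLp {Ω : Type u} [MeasurableSpace Ω] (μ : Measure Ω) [IsFiniteMeasure μ]
    (p : ℝ≥0∞) : Lp ℝ ∞ μ →ₗ[ℝ] Lp ℝ p μ where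
  toFun f := ⟨(f : Ω →ₘ[μ] ℝ), Lp.antitone le_top f.2⟩
  map_add' _ _ := rfl
  map_smul' _ _ := rfl

/-- A Lipschitz map `T : X → Y` is strongly Lipschitz `p`-integral if there are a probability space
`(Ω, Σ, μ)`, a bounded linear operator `A : X → L_∞(μ)` and a Lipschitz map `B : L_p(μ) → Y**` with
`J_Y ∘ T = B ∘ I_{∞,p} ∘ A`. Taking `Ω` in the universe of `X` is no restriction: a factorization
through any probability space can be moved to the set of functions `X → ℝ` (push `μ` forward along
representatives of the functions `A x`). -/
def StronglyLipschitzIntegral {X : Type u} {Y : Type v}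
    [NormedAddCommGroup X] [NormedSpace ℝ X] [NormedAddCommGroup Y] [NormedSpace ℝ Y]
    (p : ℝ≥0∞) [Fact (1 ≤ p)] (T : X → Y) : Prop :=
  (∃ K : ℝ≥0, LipschitzWith K T) ∧
    ∃ (Ω : Type u) (_ : MeasurableSpace Ω) (μ : Measure Ω) (_ : IsProbabilityMeasure μ)
      (A : X →L[ℝ] Lp ℝ ∞ μ) (B : Lp ℝ p μ → StrongDual ℝ (StrongDual ℝ Y)),
      (∃ K : ℝ≥0, LipschitzWith K B) ∧
        ∀ x : X, NormedSpace.inclusionInDoubleDual ℝ Y (T x) = B (inclusionLinftyLp μ p (A x))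

/-- A bounded linear operator `L : X → Z` is absolutely `p`-summing (`1 ≤ p < ∞`) if for some `C`
`(∑ ‖L xᵢ‖^p)^(1/p) ≤ C · sup_{φ ∈ B_{X*}} (∑ |φ xᵢ|^p)^(1/p)` for all finite families in `X`.
The supremum is over a non-empty bounded set of reals. -/
def AbsolutelySumming {X : Type u} {Z : Type v}
    [NormedAddCommGroup X] [NormedSpace ℝ X] [NormedAddCommGroup Z] [NormedSpace ℝ Z]
    (p : ℝ) (L : X →L[ℝ] Z) : Prop :=
  ∃ C : ℝ, 0 ≤ C ∧ ∀ (m : ℕ) (x : Fin m → X),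
    (∑ i, ‖L (x i)‖ ^ p) ^ (1 / p) ≤
      C * ⨆ φ : Metric.closedBall (0 : StrongDual ℝ X) 1,
        (∑ i, |(φ : StrongDual ℝ X) (x i)| ^ p) ^ (1 / p)

/-- A Lipschitz map `T : X → Y` is Lipschitz `p`-dominated (`1 ≤ p < ∞`) if there are a Banach space
`Z` and an absolutely `p`-summing linear operator `L : X → Z` such that
`‖T x - T y‖ ≤ ‖L x - L y‖` for all `x, y`. Taking `Z` in the universe of `X` is no restriction:
any `Z` can be replaced by the completion of `X` for the seminorm `x ↦ ‖L x‖`. -/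
def LipschitzDominated {X : Type u} {Y : Type v}
    [NormedAddCommGroup X] [NormedSpace ℝ X] [NormedAddCommGroup Y] [NormedSpace ℝ Y]
    (p : ℝ) (T : X → Y) : Prop :=
  (∃ K : ℝ≥0, LipschitzWith K T) ∧
    ∃ (Z : Type u) (_ : NormedAddCommGroup Z) (_ : NormedSpace ℝ Z) (_ : CompleteSpace Z)
      (L : X →L[ℝ] Z), AbsolutelySumming p L ∧ ∀ x y : X, ‖T x - T y‖ ≤ ‖L x - L y‖

/-! If `T` is dominated by a `p`-summing `L`, Pietsch domination gives a probability measure `μ` on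
the weak-* compact ball of `X*` with `‖L x‖ ≤ C ‖I_{∞,p} (A x)‖`, where `A` sends `x` to evaluation
at `x`. Hence `J_Y ∘ T` descends to a Lipschitz map on the range of `I_{∞,p} ∘ A`, and it remains to
extend that map to `L_p(μ)`. Here `Y* ≅ L₁(ν)` enters: averaging over finitely many disjoint sets
approximates the identity of `L₁(ν)` by contractions through `ℓ₁ⁿ`. Dually, maps into `Y**` are
approximated by maps through `ℓ_∞ⁿ`, whose real coordinates extend with the same Lipschitz constant,
and a weak-* limit of these extensions is the required `B`.

Conversely, since `J_Y` is isometric, a Lipschitz `B` makes a multiple of `I_{∞,p} ∘ A` dominate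
`T`. Such operators are `p`-summing: on finitely many vectors, almost every `ω` acts through `A` as
a functional of norm at most `‖A‖`, and the resulting pointwise bound is integrated. -/

/-! ### Lipschitz extension into dual spaces -/

/-- A real normed space has the `ℓ₁`-approximation property if its identity is approximated, on
finite sets, by finite rank operators `f ↦ ∑ i, a i f • e i` that factor through `ℓ₁ⁿ` with factors
of norm at most one. -/
def HasL1Approximation (E : Type*) [NormedAddCommGroup E] [NormedSpace ℝ E] : Prop :=
  ∀ (F : Finset E) (ε : ℝ), 0 < ε → ∃ (ι : Type) (_ : Fintype ι) (a : ι → StrongDual ℝ E)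
    (e : ι → E), (∀ i, ‖e i‖ ≤ 1) ∧ (∀ f, ∑ i, |a i f| ≤ ‖f‖) ∧
      ∀ f ∈ F, ‖∑ i, a i f • e i - f‖ < ε

theorem HasL1Approximation.congr {E E' : Type*} [NormedAddCommGroup E] [NormedSpace ℝ E]
    [NormedAddCommGroup E'] [NormedSpace ℝ E'] (hE : HasL1Approximation E) (U : E' ≃ₗᵢ[ℝ] E) :
    HasL1Approximation E' := by
  classical
  intro F ε hε
  obtain ⟨ι, _, a, e, he, ha, hF⟩ := hE (F.image U) ε hε
  refine ⟨ι, inferInstance, fun i => (a i).comp (U.toContinuousLinearEquiv : E' →L[ℝ] E),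
    fun i => U.symm (e i), fun i => by simpa using he i, fun f => by simpa using ha (U f),
    fun f hf => ?_⟩
  have h := hF (U f) (Finset.mem_image_of_mem _ hf)
  rw [← U.norm_map]
  simpa using h

/-- Each coordinate `ψ x (e i)` is real valued and `K`-Lipschitz in `φ x`, so it extends by McShane.
Recombining with the `a i` keeps the constant `K`, because `ℓ_∞ⁿ` is dual to `ℓ₁ⁿ`. The last bound,
free of `a` and `e`, is what weak-* compactness needs. -/
theorem exists_lipschitz_coordinate_extension {E M X : Type*} [NormedAddCommGroup E]
    [NormedSpace ℝ E] [PseudoMetricSpace M] (φ : X → M) (ψ : X → StrongDual ℝ E) (K : ℝ≥0)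
    (h : ∀ x y, ‖ψ x - ψ y‖ ≤ K * dist (φ x) (φ y)) (x₀ : X) {ι : Type*} [Fintype ι]
    (a : ι → StrongDual ℝ E) (e : ι → E) (he : ∀ i, ‖e i‖ ≤ 1) (ha : ∀ f, ∑ i, |a i f| ≤ ‖f‖) :
    ∃ g : M → StrongDual ℝ E, (∀ m m' f, |g m f - g m' f| ≤ K * dist m m' * ‖f‖) ∧
      (∀ x f, g (φ x) f = ψ x (∑ i, a i f • e i)) ∧
      ∀ m, ‖g m‖ ≤ ‖ψ x₀‖ + K * dist m (φ x₀) := by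
  have hcoord : ∀ i, ∃ c : M → ℝ, LipschitzWith K c ∧ ∀ x, c (φ x) = ψ x (e i) := by
    intro i
    have hdiff : ∀ x y, |ψ x (e i) - ψ y (e i)| ≤ K * dist (φ x) (φ y) := fun x y => by
      have h1 := (ψ x - ψ y).le_opNorm (e i)
      rw [sub_apply, Real.norm_eq_abs] at h1
      calc _ ≤ ‖ψ x - ψ y‖ * ‖e i‖ := h1
        _ ≤ ‖ψ x - ψ y‖ * 1 := by gcongr; exact he i
        _ ≤ _ := by rw [mul_one]; exact h x y
    have hfac : Function.FactorsThrough (fun x => ψ x (e i)) φ := fun x y hxy => by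
      have := hdiff x y
      rw [hxy, dist_self, mul_zero] at this
      exact sub_eq_zero.1 (abs_nonpos_iff.1 this)
    have hlip : LipschitzOnWith K (Function.extend φ (fun x => ψ x (e i)) 0) (Set.range φ) := by
      refine LipschitzOnWith.of_dist_le_mul ?_
      rintro _ ⟨x, rfl⟩ _ ⟨y, rfl⟩
      rw [hfac.extend_apply, hfac.extend_apply]
      exact hdiff x y
    obtain ⟨c, hc, hceq⟩ := hlip.extend_real
    exact ⟨c, hc, fun x => by rw [← hceq ⟨x, rfl⟩, hfac.extend_apply]⟩
  choose c hc hcφ using hcoord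
  have hbound : ∀ (b : ι → ℝ) (R : ℝ), (∀ i, |b i| ≤ R) → 0 ≤ R → ∀ f,
      |∑ i, b i * a i f| ≤ R * ‖f‖ := by
    intro b R hb hR f
    calc |∑ i, b i * a i f| ≤ ∑ i, |b i * a i f| := Finset.abs_sum_le_sum_abs _ _
      _ ≤ ∑ i, R * |a i f| := Finset.sum_le_sum fun i _ => by
          rw [abs_mul]; gcongr; exact hb i
      _ = R * ∑ i, |a i f| := by rw [Finset.mul_sum]
      _ ≤ R * ‖f‖ := by gcongr; exact ha f
  refine ⟨fun m => ∑ i, c i m • a i, fun m m' f => ?_, fun x f => ?_, fun m => ?_⟩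
  · have := hbound (fun i => c i m - c i m') (K * dist m m') (fun i => (hc i).dist_le_mul m m')
      (by positivity) f
    simpa [sum_apply, sub_mul] using this
  · simp [hcφ, mul_comm]
  · refine ContinuousLinearMap.opNorm_le_bound _ (by positivity) fun f => ?_
    have := hbound (fun i => c i m) (‖ψ x₀‖ + K * dist m (φ x₀)) (fun i => ?_) (by positivity) f
    · simpa [sum_apply] using this
    · have h1 : |c i m - c i (φ x₀)| ≤ K * dist m (φ x₀) := (hc i).dist_le_mul m (φ x₀)
      have h2 : |c i (φ x₀)| ≤ ‖ψ x₀‖ := by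
        rw [hcφ, ← Real.norm_eq_abs]
        exact ((ψ x₀).le_opNorm _).trans (mul_le_of_le_one_right (norm_nonneg _) (he i))
      have h3 := abs_add_le (c i m - c i (φ x₀)) (c i (φ x₀))
      rw [sub_add_cancel] at h3
      linarith

/-- Pointwise weak-* limit of the coordinate extensions along finer and finer approximations of the
identity; the Lipschitz bound survives the limit. -/
theorem HasL1Approximation.exists_lipschitz_extension {E M X : Type*} [NormedAddCommGroup E]
    [NormedSpace ℝ E] (hE : HasL1Approximation E) [PseudoMetricSpace M] [Nonempty X]
    (φ : X → M) (ψ : X → StrongDual ℝ E) (K : ℝ≥0)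
    (h : ∀ x y, ‖ψ x - ψ y‖ ≤ K * dist (φ x) (φ y)) :
    ∃ B : M → StrongDual ℝ E, LipschitzWith K B ∧ ∀ x, B (φ x) = ψ x := by
  classical
  obtain ⟨x₀⟩ := ‹Nonempty X›
  choose ι hι a e he ha hF using fun q : Finset E × ℕ =>
    hE q.1 (1 / ((q.2 : ℝ) + 1)) Nat.one_div_pos_of_nat
  choose g hglip hgφ hgnorm using fun q =>
    exists_lipschitz_coordinate_extension φ ψ K h x₀ (a q) (e q) (he q) (ha q)
  -- One ultrafilter serves all points `m`, so that differences of limits are limits of differences.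
  let U : Ultrafilter (Finset E × ℕ) := Ultrafilter.of Filter.atTop
  have hU : (U : Filter (Finset E × ℕ)) ≤ Filter.atTop := Ultrafilter.of_le _
  have hlim : ∀ m, ∃ G : StrongDual ℝ E,
      ∀ f, Filter.Tendsto (fun q => g q m f) U (nhds (G f)) := by
    intro m
    have hcpt := WeakDual.isCompact_closedBall (𝕜 := ℝ) (0 : StrongDual ℝ E)
      (‖ψ x₀‖ + K * dist m (φ x₀))
    obtain ⟨G, -, hG⟩ := hcpt.ultrafilter_le_nhds
      (U.map fun q => StrongDual.toWeakDual (g q m)) (by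
        rw [Filter.le_principal_iff]
        refine Filter.mem_map.2 (Filter.Eventually.of_forall fun q => ?_)
        simpa using hgnorm q m)
    refine ⟨WeakDual.toStrongDual G, fun f => ?_⟩
    exact ((WeakDual.eval_continuous f).tendsto G).comp hG
  choose B hB using hlim
  refine ⟨B, LipschitzWith.of_dist_le_mul fun m m' => ?_, fun x => ?_⟩
  · rw [dist_eq_norm]
    refine ContinuousLinearMap.opNorm_le_bound _ (by positivity) fun f => ?_
    exact le_of_tendsto ((hB m f).sub (hB m' f)).abs
      (Filter.Eventually.of_forall fun q => hglip q m m' f)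
  · ext f
    refine tendsto_nhds_unique (hB (φ x) f) ?_
    have h1 : Filter.Tendsto (fun q : Finset E × ℕ => ∑ i, a q i f • e q i)
        Filter.atTop (nhds f) := by
      rw [tendsto_iff_norm_sub_tendsto_zero]
      refine squeeze_zero' (Filter.Eventually.of_forall fun q => norm_nonneg _) ?_
        (tendsto_one_div_add_atTop_nhds_zero_nat.comp
          (Filter.prod_atTop_atTop_eq (α := Finset E) (β := ℕ) ▸ Filter.tendsto_snd))
      filter_upwards [Filter.eventually_ge_atTop (({f}, 0) : Finset E × ℕ)] with q hq
      exact (hF q f (hq.1 (Finset.mem_singleton_self f))).le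
    have h2 := (((ψ x).continuous.tendsto f).comp h1).mono_left hU
    simpa only [hgφ, Function.comp_def] using h2

/-! ### The `ℓ₁`-approximation property of `L₁` -/

/-- Averaging over finitely many disjoint sets of finite measure: a contraction of `L₁` that factors
through `ℓ₁ⁿ` and fixes the indicators of these sets. -/
theorem exists_l1_averaging {Ω ι : Type*} [MeasurableSpace Ω] (ν : Measure Ω) [Fintype ι]
    (A : ι → Set Ω) (hA : ∀ i, MeasurableSet (A i)) (hν : ∀ i, ν (A i) ≠ ∞)
    (hd : Pairwise (Function.onFun Disjoint A)) :
    ∃ (a : ι → StrongDual ℝ (Lp ℝ 1 ν)) (e : ι → Lp ℝ 1 ν), (∀ i, ‖e i‖ ≤ 1) ∧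
      (∀ f, ∑ i, |a i f| ≤ ‖f‖) ∧ ∀ j, ∑ i, a i (indicatorConstLp 1 (hA j) (hν j) 1) • e i =
        indicatorConstLp 1 (hA j) (hν j) 1 := by
  have hint : ∀ f : Lp ℝ 1 ν, Integrable f ν := L1.integrable_coeFn
  have hsum : ∀ f : Lp ℝ 1 ν, ∑ i, |∫ x in A i, f x ∂ν| ≤ ‖f‖ := fun f => by
    calc ∑ i, |∫ x in A i, f x ∂ν| ≤ ∑ i, ∫ x in A i, ‖f x‖ ∂ν :=
          Finset.sum_le_sum fun i _ => norm_integral_le_integral_norm (f : Ω → ℝ)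
      _ = ∫ x in ⋃ i, A i, ‖f x‖ ∂ν :=
          (integral_iUnion_fintype hA hd fun i => (hint f).norm.integrableOn).symm
      _ ≤ ∫ x, ‖f x‖ ∂ν :=
          setIntegral_le_integral (hint f).norm (Filter.Eventually.of_forall fun x => norm_nonneg _)
      _ = ‖f‖ := (L1.norm_eq_integral_norm f).symm
  let a : ι → StrongDual ℝ (Lp ℝ 1 ν) := fun i => LinearMap.mkContinuous
    { toFun := fun f => ∫ x in A i, f x ∂ν
      map_add' := fun f g => by
        rw [← integral_add (hint f).integrableOn (hint g).integrableOn]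
        exact integral_congr_ae (ae_restrict_of_ae (Lp.coeFn_add f g))
      map_smul' := fun c f => by
        rw [RingHom.id_apply, ← integral_smul]
        exact integral_congr_ae (ae_restrict_of_ae (Lp.coeFn_smul c f)) } 1 fun f => by
      rw [one_mul]
      exact (Finset.single_le_sum (f := fun i => |∫ x in A i, f x ∂ν|)
        (fun i _ => abs_nonneg _) (Finset.mem_univ i)).trans (hsum f)
  have ha : ∀ i f, a i f = ∫ x in A i, f x ∂ν := fun _ _ => rfl
  have hnorm : ∀ i, ‖indicatorConstLp 1 (hA i) (hν i) (1 : ℝ)‖ = ν.real (A i) := fun i => by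
    rw [norm_indicatorConstLp one_ne_zero ENNReal.one_ne_top]; simp
  refine ⟨a, fun i => (ν.real (A i))⁻¹ • indicatorConstLp 1 (hA i) (hν i) 1, fun i => ?_, hsum,
    fun j => ?_⟩
  · rw [norm_smul, hnorm, Real.norm_of_nonneg (by positivity)]
    exact inv_mul_le_one
  · rw [Finset.sum_eq_single j]
    · rw [ha, setIntegral_indicatorConstLp (hA j), Set.inter_self, smul_eq_mul, mul_one, smul_smul]
      -- On a null set the inverse is `0` by convention, which is harmless since the indicator class
      -- is zero too.
      by_cases h0 : ν.real (A j) = 0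
      · have : indicatorConstLp 1 (hA j) (hν j) (1 : ℝ) = 0 := by
          rw [← norm_eq_zero, hnorm, h0]
        rw [this, smul_zero]
      · rw [mul_inv_cancel₀ h0, one_smul]
    · intro i _ hij
      rw [ha, setIntegral_indicatorConstLp (hA i), (hd hij.symm).inter_eq]
      simp
    · simp

/-- Finitely many simple functions of finite support are combinations of the indicators of finitely
many disjoint sets of finite measure. -/
theorem exists_common_partition {Ω ι : Type*} [MeasurableSpace Ω] (ν : Measure Ω) [Fintype ι]
    (s : ι → SimpleFunc Ω ℝ) (hs : ∀ i, MemLp (s i) 1 ν) :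
    ∃ (n : ℕ) (A : Fin n → Set Ω) (_ : ∀ j, MeasurableSet (A j)) (_ : ∀ j, ν (A j) ≠ ∞)
      (_ : Pairwise (Function.onFun Disjoint A)) (c : ι → Fin n → ℝ),
      ∀ i ω, s i ω = ∑ j, c i j * (A j).indicator (fun _ => (1 : ℝ)) ω := by
  classical
  -- The sets are the joint fibres. The zero value is dropped: its fibre is the only one that may
  -- have infinite measure.
  let V : Finset (ι → ℝ) := (Fintype.piFinset fun i => (s i).range).filter (· ≠ 0)
  let σ := V.equivFin
  let A : Fin V.card → Set Ω := fun j => ⋂ i, s i ⁻¹' {(σ.symm j : ι → ℝ) i}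
  have hmem : ∀ j ω, ω ∈ A j ↔ (fun i => s i ω) = σ.symm j := fun j ω => by
    simp [A, funext_iff]
  refine ⟨V.card, A, fun j => MeasurableSet.iInter fun i => (s i).measurableSet_fiber _,
    fun j => ?_, fun j k hjk => ?_, fun i j => (σ.symm j : ι → ℝ) i, fun i ω => ?_⟩
  · obtain ⟨i, hi⟩ := Function.ne_iff.1 (Finset.mem_filter.1 (σ.symm j).2).2
    exact ((measure_mono (Set.iInter_subset _ i)).trans_lt
      ((s i).measure_preimage_lt_top_of_memLp one_ne_zero ENNReal.one_ne_top (hs i) _ hi)).ne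
  · refine Set.disjoint_left.2 fun ω h1 h2 => hjk ?_
    exact σ.symm.injective (Subtype.ext (((hmem j ω).1 h1).symm.trans ((hmem k ω).1 h2)))
  · by_cases h0 : (fun i => s i ω) = 0
    · rw [Finset.sum_eq_zero, congrFun h0 i, Pi.zero_apply]
      intro j _
      by_cases hj : ω ∈ A j
      · beta_reduce
        rw [← (hmem j ω).1 hj, h0, Pi.zero_apply, zero_mul]
      · rw [Set.indicator_of_notMem hj, mul_zero]
    · have hV : (fun i => s i ω) ∈ V :=
        Finset.mem_filter.2 ⟨Fintype.mem_piFinset.2 fun i => (s i).mem_range_self ω, h0⟩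
      have hj : ω ∈ A (σ ⟨_, hV⟩) := (hmem _ ω).2 (by simp)
      rw [Finset.sum_eq_single (σ ⟨_, hV⟩), Set.indicator_of_mem hj, mul_one]
      · exact congrFun ((hmem _ ω).1 hj) i
      · intro k _ hk
        rw [Set.indicator_of_notMem, mul_zero]
        intro hk'
        exact hk (by rw [← σ.symm_apply_eq]; exact Subtype.ext ((hmem k ω).1 hk').symm)
      · simp

/-- Approximate `F` by simple functions within `ε / 2`; averaging over their common partition fixes
them and is a contraction, so the error at most doubles. -/
theorem hasL1Approximation_L1 {Ω : Type*} [MeasurableSpace Ω] (ν : Measure Ω) :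
    HasL1Approximation (Lp ℝ 1 ν) := by
  intro F ε hε
  choose s hs using fun f : Lp ℝ 1 ν =>
    (Lp.simpleFunc.denseRange (E := ℝ) (μ := ν) ENNReal.one_ne_top).exists_dist_lt f (half_pos hε)
  obtain ⟨n, A, hA, hν, hd, c, hc⟩ := exists_common_partition ν
    (fun f : F => Lp.simpleFunc.toSimpleFunc (s f)) fun f => Lp.simpleFunc.memLp (s f)
  obtain ⟨a, e, he, ha, hfix⟩ := exists_l1_averaging ν A hA hν hd
  refine ⟨Fin n, inferInstance, a, e, he, ha, fun f hf => ?_⟩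
  let E : Lp ℝ 1 ν →ₗ[ℝ] Lp ℝ 1 ν := ∑ i, (a i : Lp ℝ 1 ν →ₗ[ℝ] ℝ).smulRight (e i)
  have hE : ∀ g, E g = ∑ i, a i g • e i := fun g => by simp [E]
  have hEnorm : ∀ g, ‖E g‖ ≤ ‖g‖ := fun g => by
    rw [hE]
    refine (norm_sum_le _ _).trans (le_trans (Finset.sum_le_sum fun i _ => ?_) (ha g))
    rw [norm_smul]
    exact mul_le_of_le_one_right (norm_nonneg _) (he i)
  have hsf : (s f : Lp ℝ 1 ν) = ∑ j, c ⟨f, hf⟩ j • indicatorConstLp 1 (hA j) (hν j) (1 : ℝ) := by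
    refine Lp.ext ?_
    refine (Lp.simpleFunc.toSimpleFunc_eq_toFun (s f)).symm.trans ?_
    have h1 : ∀ j, ⇑(c ⟨f, hf⟩ j • indicatorConstLp 1 (hA j) (hν j) (1 : ℝ)) =ᵐ[ν]
        fun ω => c ⟨f, hf⟩ j * (A j).indicator (fun _ => (1 : ℝ)) ω := fun j => by
      filter_upwards [Lp.coeFn_smul (c ⟨f, hf⟩ j) (indicatorConstLp 1 (hA j) (hν j) (1 : ℝ)),
        indicatorConstLp_coeFn (p := 1) (hs := hA j) (hμs := hν j) (c := (1 : ℝ))] with ω h h'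
      rw [h, Pi.smul_apply, h', smul_eq_mul]
    filter_upwards [Lp.coeFn_finsetSum Finset.univ
      (fun j => c ⟨f, hf⟩ j • indicatorConstLp 1 (hA j) (hν j) (1 : ℝ)),
      ae_all_iff.2 h1] with ω h2 h3
    rw [h2, Finset.sum_apply, hc ⟨f, hf⟩ ω]
    exact Finset.sum_congr rfl fun j _ => (h3 j).symm
  have hEs : E (s f) = s f := by
    rw [hsf, map_sum]
    exact Finset.sum_congr rfl fun j _ => by rw [map_smul, hE, hfix]
  have h1 : ‖f - s f‖ < ε / 2 := by rw [← dist_eq_norm]; exact hs f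
  rw [← hE]
  calc ‖E f - f‖ = ‖E (f - s f) - (f - s f)‖ := by rw [map_sub, hEs]; congr 1; abel
    _ ≤ ‖E (f - s f)‖ + ‖f - s f‖ := norm_sub_le _ _
    _ < ε := by linarith [hEnorm (f - s f)]

/-! ### Pietsch domination and factorization -/

theorem exists_probabilityMeasure_integral_eq {K : Type*} [TopologicalSpace K] [CompactSpace K]
    [T2Space K] [MeasurableSpace K] [BorelSpace K] (Λ : C(K, ℝ) →ₗ[ℝ] ℝ)
    (hpos : ∀ f : C(K, ℝ), (∀ x, 0 ≤ f x) → 0 ≤ Λ f) (hone : Λ 1 = 1) :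
    ∃ μ : Measure K, IsProbabilityMeasure μ ∧ ∀ f : C(K, ℝ), ∫ x, f x ∂μ = Λ f := by
  let Λ' : CompactlySupportedContinuousMap K ℝ →ₚ[ℝ] ℝ := PositiveLinearMap.mk₀
    { toFun := fun f => Λ f.toContinuousMap
      map_add' := fun f g => map_add Λ f.toContinuousMap g.toContinuousMap
      map_smul' := fun c f => map_smul Λ c f.toContinuousMap } fun f hf => hpos _ fun x => hf x
  have hint : ∀ f : C(K, ℝ), ∫ x, f x ∂(RealRMK.rieszMeasure Λ') = Λ f := fun f =>
    RealRMK.integral_rieszMeasure Λ' (CompactlySupportedContinuousMap.continuousMapEquiv f)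
  refine ⟨RealRMK.rieszMeasure Λ', ⟨?_⟩, hint⟩
  have h := hint 1
  rw [hone] at h
  simp only [ContinuousMap.one_apply, integral_const, smul_eq_mul, mul_one] at h
  rwa [measureReal_def, ENNReal.toReal_eq_one_iff] at h

/-- Hahn–Banach separates `S` from the open convex set of strictly negative functions, which it
misses; the separating functional is then normalized at `1`. -/
theorem exists_positive_functional_nonneg_on {K : Type*} [TopologicalSpace K] [CompactSpace K]
    (S : Set C(K, ℝ)) (hS : Convex ℝ S) (h0 : 0 ∈ S) (hnn : ∀ g ∈ S, ∃ x, 0 ≤ g x) :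
    ∃ Λ : C(K, ℝ) →ₗ[ℝ] ℝ, (∀ f : C(K, ℝ), (∀ x, 0 ≤ f x) → 0 ≤ Λ f) ∧ Λ 1 = 1 ∧
      ∀ g ∈ S, 0 ≤ Λ g := by
  let N : Set C(K, ℝ) := {f | ∀ x, f x < 0}
  have hNo : IsOpen N := by
    have := ContinuousMap.isOpen_setOfPred_mapsTo (X := K) isCompact_univ (isOpen_Iio (a := (0 : ℝ)))
    simpa [N, Set.MapsTo] using this
  have hNc : Convex ℝ N := by
    intro f hf g hg a b ha hb hab x
    have h := (convex_Iio (0 : ℝ)) (hf x) (hg x) ha hb hab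
    simpa using h
  have hdisj : Disjoint N S := Set.disjoint_left.2 fun f hf hfS => by
    obtain ⟨x, hx⟩ := hnn f hfS
    exact absurd (hf x) (not_lt.2 hx)
  obtain ⟨Λ, u, hN, hSu⟩ := geometric_hahn_banach_open hNc hNo hS hdisj
  have hu : u ≤ 0 := by simpa using hSu 0 h0
  have hneg : ∀ f ∈ N, Λ f < 0 := fun f hf => (hN f hf).trans_le hu
  have hone : 0 < Λ 1 := by
    have h := hneg (-1) fun x => by simp
    rw [map_neg] at h
    linarith
  have hpos : ∀ f : C(K, ℝ), (∀ x, 0 ≤ f x) → 0 ≤ Λ f := fun f hf => by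
    refine le_of_forall_pos_le_add fun ε hε => ?_
    have hδ : 0 < ε / Λ 1 := div_pos hε hone
    have h := hneg (-f - (ε / Λ 1) • 1) fun x => by simpa using by linarith [hf x]
    rw [map_sub, map_neg, map_smul, smul_eq_mul, div_mul_cancel₀ _ hone.ne'] at h
    linarith
  -- Small negative constants lie in `N`, and `Λ` is nearly zero there.
  have hu0 : 0 ≤ u := by
    refine le_of_forall_pos_le_add fun ε hε => ?_
    have hδ : 0 < ε / Λ 1 := div_pos hε hone
    have h := hN (-((ε / Λ 1) • 1)) fun x => by simpa using hδ
    rw [map_neg, map_smul, smul_eq_mul, div_mul_cancel₀ _ hone.ne'] at h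
    linarith
  refine ⟨(Λ 1)⁻¹ • (Λ : C(K, ℝ) →ₗ[ℝ] ℝ), fun f hf => ?_, ?_, fun g hg => ?_⟩
  · exact mul_nonneg (inv_nonneg.2 hone.le) (hpos f hf)
  · exact inv_mul_cancel₀ hone.ne'
  · exact mul_nonneg (inv_nonneg.2 hone.le) (hu0.trans (hSu g hg))

/-- The closed unit ball of the dual with the weak-* topology. -/
abbrev WeakDualBall (X : Type u) [NormedAddCommGroup X] [NormedSpace ℝ X] : Type u :=
  (WeakDual.toStrongDual ⁻¹' Metric.closedBall (0 : StrongDual ℝ X) 1 : Set (WeakDual ℝ X))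

instance (X : Type u) [NormedAddCommGroup X] [NormedSpace ℝ X] : CompactSpace (WeakDualBall X) :=
  isCompact_iff_compactSpace.1 (WeakDual.isCompact_closedBall (0 : StrongDual ℝ X) 1)

/-- Elements of `X` as continuous functions on the dual unit ball. -/
noncomputable def weakDualBallEval (X : Type u) [NormedAddCommGroup X] [NormedSpace ℝ X] :
    X →L[ℝ] C(WeakDualBall X, ℝ) :=
  LinearMap.mkContinuous
    { toFun := fun x => ⟨fun φ => φ.1 x, (WeakDual.eval_continuous x).comp continuous_subtype_val⟩
      map_add' := fun x y => by ext φ; exact map_add φ.1 x y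
      map_smul' := fun c x => by ext φ; exact map_smul φ.1 c x } 1 fun x => by
    rw [ContinuousMap.norm_le _ (by positivity)]
    intro φ
    have h := mem_closedBall_zero_iff.1 φ.2
    exact ((WeakDual.toStrongDual φ.1).le_opNorm x).trans (by gcongr)

@[simp]
theorem weakDualBallEval_apply {X : Type u} [NormedAddCommGroup X] [NormedSpace ℝ X] (x : X)
    (φ : WeakDualBall X) : weakDualBallEval X x φ = φ.1 x := rfl

/-- Weak-* compactness of the dual ball makes the supremum attained. -/
theorem AbsolutelySumming.exists_pos_le {X Z : Type*} [NormedAddCommGroup X]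
    [NormedSpace ℝ X] [NormedAddCommGroup Z] [NormedSpace ℝ Z] {p : ℝ} (hp : 1 ≤ p)
    {L : X →L[ℝ] Z} (hL : AbsolutelySumming p L) :
    ∃ C : ℝ, 0 ≤ C ∧ ∀ (m : ℕ) (x : Fin m → X), ∃ φ : WeakDualBall X,
      ∑ i, ‖L (x i)‖ ^ p ≤ C ^ p * ∑ i, |φ.1 (x i)| ^ p := by
  obtain ⟨C, hC, h⟩ := hL
  have hp0 : 0 < p := by linarith
  refine ⟨C, hC, fun m x => ?_⟩
  have : Nonempty (WeakDualBall X) := ⟨⟨0, by simp⟩⟩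
  have hcont : Continuous fun φ : WeakDualBall X => ∑ i, |φ.1 (x i)| ^ p := by
    refine continuous_finsetSum _ fun i _ => ?_
    exact ((weakDualBallEval X (x i)).continuous.abs).rpow_const fun _ => Or.inr hp0.le
  obtain ⟨φ, -, hφ⟩ := isCompact_univ.exists_isMaxOn Set.univ_nonempty hcont.continuousOn
  refine ⟨φ, ?_⟩
  have hsup : (⨆ ψ : Metric.closedBall (0 : StrongDual ℝ X) 1,
      (∑ i, |(ψ : StrongDual ℝ X) (x i)| ^ p) ^ (1 / p)) ≤ (∑ i, |φ.1 (x i)| ^ p) ^ (1 / p) := by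
    have : Nonempty (Metric.closedBall (0 : StrongDual ℝ X) 1) := ⟨⟨0, by simp⟩⟩
    refine ciSup_le fun ψ => Real.rpow_le_rpow (by positivity) ?_ (by positivity)
    exact hφ (Set.mem_univ (⟨StrongDual.toWeakDual ψ.1, ψ.2⟩ : WeakDualBall X))
  have h1 := Real.rpow_le_rpow (by positivity) ((h m x).trans (mul_le_mul_of_nonneg_left hsup hC)) hp0.le
  rwa [Real.mul_rpow hC (by positivity), ← Real.rpow_mul (by positivity),
    ← Real.rpow_mul (by positivity), one_div_mul_cancel hp0.ne', Real.rpow_one,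
    Real.rpow_one] at h1

/-- **Pietsch domination theorem**. -/
theorem AbsolutelySumming.exists_measure_le {X Z : Type*} [NormedAddCommGroup X]
    [NormedSpace ℝ X] [NormedAddCommGroup Z] [NormedSpace ℝ Z] {p : ℝ} (hp : 1 ≤ p)
    {L : X →L[ℝ] Z} (hL : AbsolutelySumming p L) [MeasurableSpace (WeakDualBall X)]
    [BorelSpace (WeakDualBall X)] :
    ∃ (μ : Measure (WeakDualBall X)) (C : ℝ), IsProbabilityMeasure μ ∧ 0 ≤ C ∧
      ∀ x, ‖L x‖ ^ p ≤ C ^ p * ∫ φ, |φ.1 x| ^ p ∂μ := by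
  have hp0 : 0 < p := by linarith
  obtain ⟨C, hC, h⟩ := hL.exists_pos_le hp
  let P : X → C(WeakDualBall X, ℝ) := fun x =>
    ⟨fun φ => |φ.1 x| ^ p, ((weakDualBallEval X x).continuous.abs).rpow_const
      fun _ => Or.inr hp0.le⟩
  have hP : ∀ x φ, P x φ = |φ.1 x| ^ p := fun _ _ => rfl
  let G : X → C(WeakDualBall X, ℝ) := fun x => C ^ p • P x - ‖L x‖ ^ p • 1
  have hG : ∀ x φ, G x φ = C ^ p * |φ.1 x| ^ p - ‖L x‖ ^ p := fun x φ => by simp [G, hP]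
  -- `G` is homogeneous of degree `p`; this absorbs convex weights into the vectors and makes the
  -- set `S` of finite sums convex.
  have hsmul : ∀ (t : ℝ) (x : X), 0 ≤ t → G (t ^ (1 / p) • x) = t • G x := fun t x ht => by
    ext φ
    have ht' : (0 : ℝ) ≤ t ^ (1 / p) := by positivity
    rw [ContinuousMap.smul_apply, hG, hG, map_smul, map_smul, norm_smul, smul_eq_mul, abs_mul,
      Real.norm_of_nonneg ht', abs_of_nonneg ht', Real.mul_rpow ht' (abs_nonneg _),
      Real.mul_rpow ht' (norm_nonneg _), ← Real.rpow_mul ht, one_div_mul_cancel hp0.ne',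
      Real.rpow_one, smul_eq_mul]
    ring
  let S : Set C(WeakDualBall X, ℝ) := {g | ∃ (m : ℕ) (x : Fin m → X), g = ∑ i, G (x i)}
  have hS : Convex ℝ S := by
    rintro _ ⟨m, x, rfl⟩ _ ⟨n, y, rfl⟩ a b ha hb -
    refine ⟨m + n, Fin.append (fun i => a ^ (1 / p) • x i) (fun i => b ^ (1 / p) • y i), ?_⟩
    simp [Fin.sum_univ_add, hsmul _ _ ha, hsmul _ _ hb, Finset.smul_sum, -one_div]
  obtain ⟨Λ, hpos, hone, hΛ⟩ := exists_positive_functional_nonneg_on S hS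
    ⟨0, Fin.elim0, by simp⟩ (by
      rintro _ ⟨m, x, rfl⟩
      obtain ⟨φ, hφ⟩ := h m x
      refine ⟨φ, ?_⟩
      rw [ContinuousMap.sum_apply]
      simpa [hG, Finset.sum_sub_distrib, ← Finset.mul_sum] using hφ)
  obtain ⟨μ, hμ, hint⟩ := exists_probabilityMeasure_integral_eq Λ hpos hone
  refine ⟨μ, C, hμ, hC, fun x => ?_⟩
  have h1 := hΛ (G x) ⟨1, fun _ => x, by simp⟩
  have h2 := hint (P x)
  simp only [hP] at h2
  rw [h2]
  simp only [G, map_sub, map_smul, hone, smul_eq_mul, mul_one] at h1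
  linarith

theorem norm_inclusionLinftyLp_rpow {Ω : Type*} [MeasurableSpace Ω] (μ : Measure Ω)
    [IsFiniteMeasure μ] (p : ℝ≥0∞) [Fact (1 ≤ p)] (hp : p ≠ ∞) (f : Lp ℝ ∞ μ) :
    ‖inclusionLinftyLp μ p f‖ ^ p.toReal = ∫ ω, |f ω| ^ p.toReal ∂μ := by
  have hp0 : p ≠ 0 := (zero_lt_one.trans_le Fact.out).ne'
  have hp1 : 0 < p.toReal := ENNReal.toReal_pos hp0 hp
  have hf : MemLp f p μ := (Lp.memLp f).mono_exponent le_top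
  have hn : ‖inclusionLinftyLp μ p f‖ = (eLpNorm f p μ).toReal := rfl
  have hi : 0 ≤ ∫ ω, |f ω| ^ p.toReal ∂μ := integral_nonneg fun ω => by positivity
  rw [hn, hf.eLpNorm_eq_integral_rpow_norm hp0 hp, ENNReal.toReal_ofReal (by positivity)]
  simp only [Real.norm_eq_abs]
  rw [← Real.rpow_mul hi, inv_mul_cancel₀ hp1.ne', Real.rpow_one]

/-- **Pietsch factorization**: an absolutely `p`-summing operator is dominated by an operator
`I_{∞,p} ∘ A` with `A` into some `L_∞(μ)`. -/
theorem AbsolutelySumming.exists_inclusionLinftyLp {X : Type u} {Z : Type v} [NormedAddCommGroup X]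
    [NormedSpace ℝ X] [NormedAddCommGroup Z] [NormedSpace ℝ Z] (p : ℝ≥0∞) [Fact (1 ≤ p)]
    (hp : p ≠ ∞) {L : X →L[ℝ] Z} (hL : AbsolutelySumming p.toReal L) :
    ∃ (Ω : Type u) (_ : MeasurableSpace Ω) (μ : Measure Ω) (_ : IsProbabilityMeasure μ)
      (A : X →L[ℝ] Lp ℝ ∞ μ) (C : ℝ≥0), ∀ x, ‖L x‖ ≤ C * ‖inclusionLinftyLp μ p (A x)‖ := by
  have hp1 : 1 ≤ p.toReal := by
    rw [← ENNReal.toReal_one]; exact ENNReal.toReal_mono hp Fact.out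
  have hp0 : 0 < p.toReal := by linarith
  borelize (WeakDualBall X)
  obtain ⟨μ, C, hμ, hC, h⟩ := hL.exists_measure_le hp1
  refine ⟨WeakDualBall X, inferInstance, μ, hμ,
    (ContinuousMap.toLp ∞ μ ℝ).comp (weakDualBallEval X), ⟨C, hC⟩, fun x => ?_⟩
  refine (Real.rpow_le_rpow_iff (norm_nonneg _) (mul_nonneg hC (norm_nonneg _)) hp0).1 ?_
  rw [Real.mul_rpow hC (norm_nonneg _), norm_inclusionLinftyLp_rpow μ p hp]
  refine (h x).trans_eq ?_
  congr 1
  refine integral_congr_ae ?_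
  filter_upwards [ContinuousMap.coeFn_toLp (p := ∞) (𝕜 := ℝ) μ (weakDualBallEval X x)] with φ hφ
  rw [ContinuousLinearMap.comp_apply, hφ, weakDualBallEval_apply]

/-! ### Operators through `I_{∞,p}` are absolutely `p`-summing -/

/-- **Helly's theorem** on the existence of a functional with prescribed values. -/
theorem exists_dual_eq_of_forall_abs_sum_le {ι X : Type*} [Fintype ι] [NormedAddCommGroup X]
    [NormedSpace ℝ X] (x : ι → X) (c : ι → ℝ) {M : ℝ} (hM : 0 ≤ M)
    (h : ∀ a : ι → ℝ, |∑ i, a i * c i| ≤ M * ‖∑ i, a i • x i‖) :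
    ∃ φ : StrongDual ℝ X, ‖φ‖ ≤ M ∧ ∀ i, φ (x i) = c i := by
  classical
  let s : (ι → ℝ) →ₗ[ℝ] X := Fintype.linearCombination ℝ x
  let t : (ι → ℝ) →ₗ[ℝ] ℝ := Fintype.linearCombination ℝ c
  have hst : ∀ a, |t a| ≤ M * ‖s a‖ := fun a => by
    simpa [s, t, Fintype.linearCombination_apply] using h a
  obtain ⟨g, hg⟩ := s.rangeRestrict.exists_rightInverse_of_surjective s.range_rangeRestrict
  have hg' : ∀ v, s (g v) = v := fun v => congrArg Subtype.val (LinearMap.congr_fun hg v)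
  let f : StrongDual ℝ (LinearMap.range s) := (t ∘ₗ g).mkContinuous M fun v => by
    have := hst (g v)
    rwa [hg'] at this
  obtain ⟨φ, hφ, hnorm⟩ := exists_extension_norm_eq (LinearMap.range s) f
  refine ⟨φ, hnorm.trans_le (LinearMap.mkContinuous_norm_le _ hM _), fun i => ?_⟩
  have hx : s (Pi.single i 1) = x i := by simp [s]
  have hc : t (Pi.single i 1) = c i := by simp [t]
  have hmem : x i ∈ LinearMap.range s := ⟨_, hx⟩
  have h1 : φ (x i) = t (g ⟨x i, hmem⟩) := hφ ⟨x i, hmem⟩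
  -- This difference lies in the kernel of `s`, where the hypothesis forces `t` to vanish.
  have h2 := hst (g ⟨x i, hmem⟩ - Pi.single i 1)
  rw [map_sub s, hg', hx, sub_self, norm_zero, mul_zero, map_sub, hc] at h2
  rw [h1]
  exact sub_eq_zero.1 (abs_nonpos_iff.1 h2)

theorem ae_abs_le_norm_Linfty {Ω : Type*} [MeasurableSpace Ω] {μ : Measure Ω} (f : Lp ℝ ∞ μ) :
    ∀ᵐ ω ∂μ, |f ω| ≤ ‖f‖ := by
  filter_upwards [enorm_ae_le_eLpNormEssSup f μ] with ω h
  rw [← eLpNorm_exponent_top, ← Lp.enorm_def] at h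
  exact enorm_le_iff_norm_le.1 h

/-- Almost everywhere, an operator into `L_∞` acts on a finite family as a functional. -/
theorem ae_exists_dual_eq {X Ω ι : Type*} [NormedAddCommGroup X] [NormedSpace ℝ X]
    [MeasurableSpace Ω] {μ : Measure Ω} [Fintype ι] (A : X →L[ℝ] Lp ℝ ∞ μ) (x : ι → X) :
    ∀ᵐ ω ∂μ, ∃ φ : StrongDual ℝ X, ‖φ‖ ≤ ‖A‖ ∧ ∀ i, φ (x i) = A (x i) ω := by
  -- Rational coefficients keep the exceptional null sets countable in number; density then gives
  -- real ones.
  have hrat : ∀ a : ι → ℚ, ∀ᵐ ω ∂μ,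
      |∑ i, (a i : ℝ) * A (x i) ω| ≤ ‖A‖ * ‖∑ i, (a i : ℝ) • x i‖ := fun a => by
    filter_upwards [ae_abs_le_norm_Linfty (A (∑ i, (a i : ℝ) • x i)),
      Lp.coeFn_finsetSum Finset.univ fun i => (a i : ℝ) • A (x i),
      ae_all_iff.2 fun i => Lp.coeFn_smul (a i : ℝ) (A (x i))] with ω h1 h2 h3
    have h4 : A (∑ i, (a i : ℝ) • x i) = ∑ i, (a i : ℝ) • A (x i) := by simp
    have h5 : A (∑ i, (a i : ℝ) • x i) ω = ∑ i, (a i : ℝ) * A (x i) ω := by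
      rw [h4, h2, Finset.sum_apply]
      exact Finset.sum_congr rfl fun i _ => h3 i
    rw [← h5]
    exact h1.trans (A.le_opNorm _)
  filter_upwards [ae_all_iff.2 hrat] with ω h
  refine exists_dual_eq_of_forall_abs_sum_le x _ (norm_nonneg _) fun a => ?_
  have hd : DenseRange (Pi.map fun (_ : ι) (q : ℚ) => (q : ℝ)) :=
    DenseRange.piMap fun _ => Rat.denseRange_cast
  refine hd.induction_on (p := fun a => |∑ i, a i * A (x i) ω| ≤ ‖A‖ * ‖∑ i, a i • x i‖) a ?_ h
  exact isClosed_le (by fun_prop) (by fun_prop)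

theorem bddAbove_range_dual_sum_rpow {ι X : Type*} [Fintype ι] [NormedAddCommGroup X]
    [NormedSpace ℝ X] (x : ι → X) {p : ℝ} (hp : 0 ≤ p) :
    BddAbove (Set.range fun φ : Metric.closedBall (0 : StrongDual ℝ X) 1 =>
      (∑ i, |(φ : StrongDual ℝ X) (x i)| ^ p) ^ (1 / p)) := by
  refine ⟨(∑ i, ‖x i‖ ^ p) ^ (1 / p), ?_⟩
  rintro _ ⟨φ, rfl⟩
  have hφ := mem_closedBall_zero_iff.1 φ.2
  refine Real.rpow_le_rpow (by positivity) (Finset.sum_le_sum fun i _ => ?_) (by positivity)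
  refine Real.rpow_le_rpow (abs_nonneg _) ?_ hp
  exact ((φ : StrongDual ℝ X).le_opNorm (x i)).trans
    (mul_le_of_le_one_left (norm_nonneg _) hφ)

/-- The canonical inclusion `L_∞(μ) → L_p(μ)` of a probability space as a bounded operator. -/
noncomputable def inclusionLinftyLpCLM {Ω : Type u} [MeasurableSpace Ω] (μ : Measure Ω)
    [IsProbabilityMeasure μ] (p : ℝ≥0∞) [Fact (1 ≤ p)] : Lp ℝ ∞ μ →L[ℝ] Lp ℝ p μ :=
  (inclusionLinftyLp μ p).mkContinuous 1 fun f => by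
    rw [one_mul]
    exact ENNReal.toReal_mono (Lp.eLpNorm_ne_top f)
      (eLpNorm_le_eLpNorm_of_exponent_le le_top (Lp.aestronglyMeasurable f))

@[simp]
theorem inclusionLinftyLpCLM_apply {Ω : Type u} [MeasurableSpace Ω] (μ : Measure Ω)
    [IsProbabilityMeasure μ] (p : ℝ≥0∞) [Fact (1 ≤ p)] (f : Lp ℝ ∞ μ) :
    inclusionLinftyLpCLM μ p f = inclusionLinftyLp μ p f := rfl

theorem absolutelySumming_inclusionLinftyLp_comp {X : Type*} [NormedAddCommGroup X]
    [NormedSpace ℝ X] {Ω : Type*} [MeasurableSpace Ω] (μ : Measure Ω) [IsProbabilityMeasure μ]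
    (p : ℝ≥0∞) [Fact (1 ≤ p)] (hp : p ≠ ∞) (A : X →L[ℝ] Lp ℝ ∞ μ) :
    AbsolutelySumming p.toReal ((inclusionLinftyLpCLM μ p).comp A) := by
  have hp0 : p ≠ 0 := (zero_lt_one.trans_le Fact.out).ne'
  have hp1 : 0 < p.toReal := ENNReal.toReal_pos hp0 hp
  -- The added `1` allows division when `A = 0`.
  have hA : 0 < ‖A‖ + 1 := by positivity
  refine ⟨‖A‖ + 1, hA.le, fun m x => ?_⟩
  set S := ⨆ φ : Metric.closedBall (0 : StrongDual ℝ X) 1,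
    (∑ i, |(φ : StrongDual ℝ X) (x i)| ^ p.toReal) ^ (1 / p.toReal)
  have hS : 0 ≤ S := Real.iSup_nonneg fun φ => by positivity
  have hpt : ∀ᵐ ω ∂μ, ∑ i, |A (x i) ω| ^ p.toReal ≤ ((‖A‖ + 1) * S) ^ p.toReal := by
    filter_upwards [ae_exists_dual_eq A x] with ω hω
    obtain ⟨φ, hφ, hφx⟩ := hω
    have hψ : (‖A‖ + 1)⁻¹ • φ ∈ Metric.closedBall (0 : StrongDual ℝ X) 1 := by
      rw [mem_closedBall_zero_iff, norm_smul, norm_inv, Real.norm_of_nonneg hA.le,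
        inv_mul_le_iff₀ hA]
      linarith
    have h1 := le_ciSup (bddAbove_range_dual_sum_rpow x hp1.le) ⟨_, hψ⟩
    have h2 := Real.rpow_le_rpow (by positivity) h1 hp1.le
    rw [← Real.rpow_mul (by positivity), one_div_mul_cancel hp1.ne', Real.rpow_one] at h2
    rw [Real.mul_rpow hA.le hS]
    refine le_trans (le_of_eq ?_) (mul_le_mul_of_nonneg_left h2 (by positivity))
    rw [Finset.mul_sum]
    refine Finset.sum_congr rfl fun i _ => ?_
    rw [← Real.mul_rpow hA.le (abs_nonneg _), smul_apply, smul_eq_mul, abs_mul, abs_inv,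
      abs_of_pos hA, mul_inv_cancel_left₀ hA.ne', hφx]
  have hint : ∀ i, Integrable (fun ω => |A (x i) ω| ^ p.toReal) μ := fun i =>
    ((Lp.memLp (A (x i))).mono_exponent le_top).integrable_norm_rpow hp0 hp
  have hsum : ∑ i, ‖((inclusionLinftyLpCLM μ p).comp A) (x i)‖ ^ p.toReal ≤
      ((‖A‖ + 1) * S) ^ p.toReal := by
    simp only [ContinuousLinearMap.comp_apply, inclusionLinftyLpCLM_apply,
      norm_inclusionLinftyLp_rpow μ p hp]
    rw [← integral_finsetSum _ fun i _ => hint i]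
    calc _ ≤ ∫ _, ((‖A‖ + 1) * S) ^ p.toReal ∂μ :=
          integral_mono_ae (integrable_finsetSum _ fun i _ => hint i) (integrable_const _) hpt
      _ = _ := by simp
  have h3 := Real.rpow_le_rpow (by positivity) hsum (z := 1 / p.toReal) (by positivity)
  rwa [← Real.rpow_mul (by positivity), mul_one_div_cancel hp1.ne', Real.rpow_one] at h3

/-! ### The two implications -/

theorem StronglyLipschitzIntegral.lipschitzDominated {X : Type u} {Y : Type v}
    [NormedAddCommGroup X] [NormedSpace ℝ X] [NormedAddCommGroup Y] [NormedSpace ℝ Y]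
    {p : ℝ≥0∞} [Fact (1 ≤ p)] (hp : p ≠ ∞) {T : X → Y} (hT : StronglyLipschitzIntegral p T) :
    LipschitzDominated p.toReal T := by
  obtain ⟨hlip, Ω, _, μ, _, A, B, ⟨K, hB⟩, hfac⟩ := hT
  refine ⟨hlip, Lp ℝ p μ, inferInstance, inferInstance, inferInstance,
    -- Domination is required with constant one, so the Lipschitz constant of `B` is absorbed into
    -- `A`.
    (inclusionLinftyLpCLM μ p).comp ((K : ℝ) • A),
    absolutelySumming_inclusionLinftyLp_comp μ p hp _, fun x y => ?_⟩
  have h := hB.dist_le_mul (inclusionLinftyLp μ p (A x)) (inclusionLinftyLp μ p (A y))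
  rw [← hfac, ← hfac, dist_eq_norm, dist_eq_norm, ← map_sub] at h
  have hJ : ‖NormedSpace.inclusionInDoubleDual ℝ Y (T x - T y)‖ = ‖T x - T y‖ :=
    (NormedSpace.inclusionInDoubleDualLi ℝ (E := Y)).norm_map _
  rw [map_sub] at hJ
  rw [hJ] at h
  refine h.trans_eq ?_
  rw [← map_sub, ← map_sub, ContinuousLinearMap.comp_apply, smul_apply,
    map_smul, norm_smul, inclusionLinftyLpCLM_apply, NNReal.norm_eq]

theorem LipschitzDominated.stronglyLipschitzIntegral {X : Type u} {Y : Type v}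
    [NormedAddCommGroup X] [NormedSpace ℝ X] [NormedAddCommGroup Y] [NormedSpace ℝ Y]
    (hY : HasL1Approximation (StrongDual ℝ Y)) {p : ℝ≥0∞} [Fact (1 ≤ p)] (hp : p ≠ ∞) {T : X → Y}
    (hT : LipschitzDominated p.toReal T) : StronglyLipschitzIntegral p T := by
  obtain ⟨hlip, Z, _, _, _, L, hL, hTL⟩ := hT
  obtain ⟨Ω, _, μ, hμ, A, C, hLA⟩ := hL.exists_inclusionLinftyLp p hp
  obtain ⟨B, hB, hfac⟩ := hY.exists_lipschitz_extension (fun x => inclusionLinftyLp μ p (A x))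
    (fun x => NormedSpace.inclusionInDoubleDual ℝ Y (T x)) C fun x y => by
      rw [dist_eq_norm, ← map_sub, ← map_sub, ← map_sub]
      refine (NormedSpace.double_dual_bound ℝ Y _).trans ((hTL x y).trans ?_)
      rw [← map_sub]
      exact hLA (x - y)
  exact ⟨hlip, Ω, _, μ, hμ, A, B, ⟨C, hB⟩, fun x => (hfac x).symm⟩

theorem mainTheorem4 {X : Type u} {Y : Type v}
    [NormedAddCommGroup X] [NormedSpace ℝ X] [CompleteSpace X]
    [NormedAddCommGroup Y] [NormedSpace ℝ Y] (hY : IsLindenstrauss.{v, w} Y)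
    (p : ℝ≥0∞) [Fact (1 ≤ p)] (hp : p ≠ ∞) (T : X → Y) :
    StronglyLipschitzIntegral p T ↔ LipschitzDominated p.toReal T := by
  obtain ⟨-, Ω, _, ν, ⟨U⟩⟩ := hY
  exact ⟨fun h => h.lipschitzDominated hp,
    fun h => h.stronglyLipschitzIntegral ((hasL1Approximation_L1 ν).congr U) hp⟩
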